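/- For integers $n \ge 1$, $d \ge 1$ let $T_d(n) = \{(x_1,\dots,x_d) \in \mathbb{Z}_{\ge 0}^d : x_1+\dots+x_d \le n-1\} \subset \mathbb{R}^d$. A fractional cover of $T_d(n)$ is an assignment of a weight $w(H) \in [0,\infty)$ to every affine hyperplane $H$ of $\mathbb{R}^d$ such that $\sum_{H \ni p} w(H) \ge 1$ for every $p \in T_d(n)$; its size is $\sum_H w(H)$. Let $f^*(n,d)$ denote the minimum size of a fractional cover of $T_d(n)$. Then for every integer $j \ge 0$ both minima below are attained, and \[ \text{(a)}\quad f^*(3j+2,2) = 2j+1+\frac{2j+1}{3j+2}, \qquad \text{(b)}\quad f^*(3j+3,2) = 2j+2+\frac{j+1}{3j+4}. \] -/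

import Mathlib

open scoped ENNReal NNReal

noncomputable section

/-- The triangular grid `T_d(n)`: the points of `ℝ^d` with nonnegative integer coordinates whose sum
is at most `n - 1` (the subtraction takes place in `ℤ`). -/
def triangularGrid (n d : ℕ) : Set (Fin d → ℝ) :=
  {p | ∃ x : Fin d → ℤ, (∀ i, 0 ≤ x i) ∧ ∑ i, x i ≤ (n : ℤ) - 1 ∧ p = fun i => (x i : ℝ)}

/-- The affine hyperplanes of `ℝ^d`: nonempty affine subspaces of dimension `d - 1`. -/
def AffineHyperplane (d : ℕ) : Type :=
  {H : AffineSubspace ℝ (Fin d → ℝ) //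
    (H : Set (Fin d → ℝ)).Nonempty ∧ Module.finrank ℝ H.direction + 1 = d}

/-- A fractional cover of `T_d(n)`: an assignment of finite nonnegative weights to all affine
hyperplanes of `ℝ^d` such that at every grid point the hyperplanes through it have total weight at
least `1`. Sums of weights are taken in `[0, ∞]`, where they always exist. -/
def IsFractionalCover (n d : ℕ) (w : AffineHyperplane d → ℝ≥0) : Prop :=
  ∀ p ∈ triangularGrid n d, 1 ≤ ∑' H : {H : AffineHyperplane d // p ∈ H.1}, (w H.1 : ℝ≥0∞)

/-- The size of a weight assignment: the total weight of all hyperplanes. -/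
def coverSize {d : ℕ} (w : AffineHyperplane d → ℝ≥0) : ℝ≥0∞ :=
  ∑' H, (w H : ℝ≥0∞)

/-- The set of sizes of fractional covers of `T_d(n)`. -/
def fractionalCoverSizes (n d : ℕ) : Set ℝ≥0∞ :=
  {s | ∃ w : AffineHyperplane d → ℝ≥0, IsFractionalCover n d w ∧ coverSize w = s}

/-- The fractional covering number `f*(n, d)`: the infimum of the sizes of fractional covers.
That the infimum is a minimum is asserted separately, by `fStar n d ∈ fractionalCoverSizes n d`. -/
def fStar (n d : ℕ) : ℝ≥0∞ := sInf (fractionalCoverSizes n d)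

end

/-! This is linear programming duality. Put `n = 3j+2+ε` with `ε ∈ {0,1}`, `m = n-1`, `K = 2j+1+ε`,
and give a grid point the coordinates `x + y + z = m`.

Upper bound (`exists_cover`): weight each of the lines `x = i`, `y = i`, `z = i` by `max(K-i,
0)/(3K-m)`, where `3K-m = 3j+2+2ε`.

Lower bound: complementary slackness asks for point weights supported where `x, y, z ≤ K`, a
hexagon, with the same sum `D = (3j+2+2ε)(j+1)` on every grid line of index below `K`. `gridWeight`
does this: it is constant on the three sides where a coordinate equals `K`, and elsewhere in the
hexagon it is three times the largest deviation of a coordinate from `m/3`. By `gridWeight_line_le`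
no line carries more than `D`. A line in any other direction meets the grid in points separated by
at least 2 in some coordinate, hence in too few points to exceed `D`. Weak duality
(`sum_le_mul_coverSize`) then matches the upper bound. -/

/-- The weight of the point with barycentric coordinates `x, y, z`. -/
def hexWeight (j ε x y z : ℕ) : ℕ :=
  if x ≤ 2 * j + 1 + ε ∧ y ≤ 2 * j + 1 + ε ∧ z ≤ 2 * j + 1 + ε then
    if x = 2 * j + 1 + ε ∨ y = 2 * j + 1 + ε ∨ z = 2 * j + 1 + ε then (2 - ε) * j + 1
    else max (max (Nat.dist (3 * x) (3 * j + 1 + ε)) (Nat.dist (3 * y) (3 * j + 1 + ε)))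
      (Nat.dist (3 * z) (3 * j + 1 + ε))
  else 0

/-- The dual weight of the grid point `(x, y)`. -/
def gridWeight (j ε x y : ℕ) : ℕ :=
  if x + y ≤ 3 * j + 1 + ε then hexWeight j ε x y (3 * j + 1 + ε - x - y) else 0

/-! ### Symmetries and pointwise bounds of the dual weight. -/

theorem hexWeight_swap (j ε x y z : ℕ) : hexWeight j ε x y z = hexWeight j ε y x z := by
  unfold hexWeight
  rw [max_comm (Nat.dist (3 * x) _)]
  congr 1
  · grind
  · congr 1
    grind

theorem hexWeight_reverse (j ε x y z : ℕ) : hexWeight j ε x y z = hexWeight j ε z y x := by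
  unfold hexWeight
  rw [max_comm (max _ _), max_comm (Nat.dist (3 * x) _), ← max_assoc]
  congr 1
  · grind
  · congr 1
    grind

theorem gridWeight_swap (j ε x y : ℕ) : gridWeight j ε x y = gridWeight j ε y x := by
  unfold gridWeight
  rw [hexWeight_swap, add_comm y x, Nat.sub_right_comm]

theorem gridWeight_reflect {j ε x y : ℕ} (h : x + y ≤ 3 * j + 1 + ε) :
    gridWeight j ε (3 * j + 1 + ε - x - y) y = gridWeight j ε x y := by
  unfold gridWeight
  rw [if_pos h, if_pos (by omega), hexWeight_reverse]
  congr 1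
  omega

theorem hexWeight_le {j ε x y z : ℕ} (hε : ε ≤ 1) (h : x + y + z = 3 * j + 1 + ε) :
    hexWeight j ε x y z ≤ 3 * j + 2 := by
  unfold hexWeight Nat.dist
  interval_cases ε
  · split_ifs <;> omega
  · split_ifs <;> omega

theorem hexWeight_of_edge {j ε x y z : ℕ} (hx : 2 * j + 1 + ε ≤ x) :
    hexWeight j ε x y z ≤ (2 - ε) * j + 1 := by
  unfold hexWeight
  split_ifs
  · exact le_rfl
  · omega
  · omega

/-! ### Row sums of the dual weight. -/

theorem sum_range_three_mul_add (a n : ℕ) :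
    2 * ∑ i ∈ Finset.range n, (3 * i + a) + 3 * n = 3 * n ^ 2 + 2 * a * n := by
  induction n with
  | zero => simp
  | succ n ih => rw [Finset.sum_range_succ]; linear_combination ih

theorem sum_range_add_five (f : ℕ → ℕ) (a b c d e : ℕ) :
    ∑ i ∈ Finset.range (a + b + c + d + e), f i =
      ∑ i ∈ Finset.range a, f i + ∑ i ∈ Finset.range b, f (a + i) +
        ∑ i ∈ Finset.range c, f (a + b + i) + ∑ i ∈ Finset.range d, f (a + b + c + i) +
        ∑ i ∈ Finset.range e, f (a + b + c + d + i) := by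
  simp only [Finset.sum_range_add]

/-- The rows on the long sides of the hexagon. -/
theorem gridWeight_row_long (t u ε : ℕ) (hε : ε ≤ 1) :
    ∑ y ∈ Finset.range (2 * (u + t) + 2 + ε), gridWeight (u + t) ε t y =
      (3 * (u + t) + 2 + 2 * ε) * (u + t + 1) := by
  -- Along the row: zeros ending in the boundary point `z = K`, then `z` deviates most, then `x`
  -- (constant weight), then `y`, then the boundary point `y = K`.
  have hlen : 2 * (u + t) + 2 + ε = (u + 1) + t + (u + ε) + t + 1 := by ring
  have h1 : ∑ y ∈ Finset.range (u + 1), gridWeight (u + t) ε t y = (2 - ε) * (u + t) + 1 := by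
    rw [Finset.sum_range_succ, Finset.sum_eq_zero, zero_add]
    · unfold gridWeight hexWeight
      rw [if_pos (by omega), if_pos (by omega), if_pos (by omega)]
    · intro y hy
      have := Finset.mem_range.1 hy
      unfold gridWeight hexWeight
      rw [if_pos (by omega), if_neg (by omega)]
  have h2 : ∑ y ∈ Finset.range t, gridWeight (u + t) ε t (u + 1 + y) =
      ∑ y ∈ Finset.range t, (3 * y + (3 * u + 2 + 2 * ε)) := by
    rw [← Finset.sum_range_reflect]
    refine Finset.sum_congr rfl fun y hy => ?_
    have := Finset.mem_range.1 hy
    unfold gridWeight hexWeight Nat.dist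
    rw [if_pos (by omega), if_pos (by omega), if_neg (by omega)]
    omega
  have h3 : ∑ y ∈ Finset.range (u + ε), gridWeight (u + t) ε t (u + 1 + t + y) =
      (u + ε) * (3 * u + 1 + ε) := by
    rw [Finset.sum_congr rfl (g := fun _ => 3 * u + 1 + ε)]
    · simp
    · intro y hy
      have := Finset.mem_range.1 hy
      unfold gridWeight hexWeight Nat.dist
      rw [if_pos (by omega), if_pos (by omega), if_neg (by omega)]
      omega
  have h4 : ∑ y ∈ Finset.range t, gridWeight (u + t) ε t (u + 1 + t + (u + ε) + y) =
      ∑ y ∈ Finset.range t, (3 * y + (3 * u + 2 + 2 * ε)) := by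
    refine Finset.sum_congr rfl fun y hy => ?_
    have := Finset.mem_range.1 hy
    unfold gridWeight hexWeight Nat.dist
    rw [if_pos (by omega), if_pos (by omega), if_neg (by omega)]
    omega
  have h5 : ∑ y ∈ Finset.range 1, gridWeight (u + t) ε t (u + 1 + t + (u + ε) + t + y) =
      (2 - ε) * (u + t) + 1 := by
    rw [Finset.sum_range_one]
    unfold gridWeight hexWeight
    rw [if_pos (by omega), if_pos (by omega), if_pos (by omega)]
  rw [hlen, sum_range_add_five, h1, h2, h3, h4, h5]
  have h6 := sum_range_three_mul_add (3 * u + 2 + 2 * ε) t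
  interval_cases ε
  · linear_combination h6
  · linear_combination h6

/-- The rows on the short sides of the hexagon, except the outermost. -/
theorem gridWeight_row_short {j ε s v : ℕ} (hε : ε ≤ 1) (hv : s + v = j + ε) (hv1 : 1 ≤ v) :
    ∑ y ∈ Finset.range (2 * j + 2 + ε), gridWeight j ε (j + 1 + s) y =
      (3 * j + 2 + 2 * ε) * (j + 1) := by
  obtain ⟨c, hc⟩ : ∃ c, c + ε = s + 1 := ⟨s + 1 - ε, by omega⟩
  -- No boundary point lies on this row. The largest deviation comes from small `y`, then from `x`,
  -- then from small `z`; the last `s + 1` positions lie outside the triangle.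
  have hlen : 2 * j + 2 + ε = v + c + v + (s + 1) + 0 := by omega
  have h1 : ∑ y ∈ Finset.range v, gridWeight j ε (j + 1 + s) y =
      ∑ y ∈ Finset.range v, (3 * y + (3 * s + 4 - 2 * ε)) := by
    rw [← Finset.sum_range_reflect]
    refine Finset.sum_congr rfl fun y hy => ?_
    have := Finset.mem_range.1 hy
    unfold gridWeight hexWeight Nat.dist
    rw [if_pos (by omega), if_pos (by omega), if_neg (by omega)]
    omega
  have h2 : ∑ y ∈ Finset.range c, gridWeight j ε (j + 1 + s) (v + y) =
      c * (3 * s + 2 - ε) := by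
    rw [Finset.sum_congr rfl (g := fun _ => 3 * s + 2 - ε)]
    · simp
    · intro y hy
      have := Finset.mem_range.1 hy
      unfold gridWeight hexWeight Nat.dist
      rw [if_pos (by omega), if_pos (by omega), if_neg (by omega)]
      omega
  have h3 : ∑ y ∈ Finset.range v, gridWeight j ε (j + 1 + s) (v + c + y) =
      ∑ y ∈ Finset.range v, (3 * y + (3 * s + 4 - 2 * ε)) := by
    refine Finset.sum_congr rfl fun y hy => ?_
    have := Finset.mem_range.1 hy
    unfold gridWeight hexWeight Nat.dist
    rw [if_pos (by omega), if_pos (by omega), if_neg (by omega)]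
    omega
  have h4 : ∑ y ∈ Finset.range (s + 1), gridWeight j ε (j + 1 + s) (v + c + v + y) = 0 := by
    refine Finset.sum_eq_zero fun y hy => ?_
    unfold gridWeight
    rw [if_neg (by omega)]
  rw [hlen, sum_range_add_five, h1, h2, h3, h4, Finset.sum_range_zero]
  have h6 := sum_range_three_mul_add (3 * s + 4 - 2 * ε) v
  interval_cases ε
  · obtain rfl : c = s + 1 := by omega
    obtain rfl : j = s + v := by omega
    simp only [mul_zero, Nat.sub_zero, add_zero] at *
    linear_combination h6
  · obtain rfl : c = s := by omega
    have e1 : 3 * c + 4 - 2 * 1 = 3 * c + 2 := by omega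
    have e2 : 3 * c + 2 - 1 = 3 * c + 1 := by omega
    rw [e1] at h6 ⊢
    rw [e2]
    obtain ⟨v, rfl⟩ : ∃ k, v = k + 1 := ⟨v - 1, by omega⟩
    obtain rfl : j = c + v := by omega
    linear_combination h6

theorem gridWeight_row {j ε i : ℕ} (hε : ε ≤ 1) (hi : i < 2 * j + 1 + ε) :
    ∑ y ∈ Finset.range (2 * j + 2 + ε), gridWeight j ε i y = (3 * j + 2 + 2 * ε) * (j + 1) := by
  rcases le_or_gt i j with h | h
  · obtain ⟨u, rfl⟩ := Nat.exists_eq_add_of_le' h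
    exact gridWeight_row_long i u ε hε
  · obtain ⟨s, rfl⟩ := Nat.exists_eq_add_of_le (show j + 1 ≤ i by omega)
    exact gridWeight_row_short (v := j + ε - s) hε (by omega) (by omega)

/-- The row `x = K` has weight zero in the optimal cover, so its sum may fall short of `D`. -/
theorem gridWeight_row_last (j ε : ℕ) :
    ∑ y ∈ Finset.range (2 * j + 2 + ε), gridWeight j ε (2 * j + 1 + ε) y =
      (j + 1) * ((2 - ε) * j + 1) := by
  have hlen : 2 * j + 2 + ε = (j + 1) + (j + 1 + ε) := by ring
  have h1 : ∑ y ∈ Finset.range (j + 1), gridWeight j ε (2 * j + 1 + ε) y =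
      (j + 1) * ((2 - ε) * j + 1) := by
    rw [Finset.sum_congr rfl (g := fun _ => (2 - ε) * j + 1)]
    · simp
    · intro y hy
      have := Finset.mem_range.1 hy
      unfold gridWeight hexWeight
      rw [if_pos (by omega), if_pos (by omega), if_pos (by omega)]
  have h2 : ∑ y ∈ Finset.range (j + 1 + ε), gridWeight j ε (2 * j + 1 + ε) (j + 1 + y) = 0 := by
    refine Finset.sum_eq_zero fun y hy => ?_
    unfold gridWeight
    rw [if_neg (by omega)]
  rw [hlen, Finset.sum_range_add, h1, h2, add_zero]

theorem gridWeight_row_le {j ε : ℕ} (hε : ε ≤ 1) (i : ℕ) :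
    ∑ y ∈ Finset.range (2 * j + 2 + ε), gridWeight j ε i y ≤
      (3 * j + 2 + 2 * ε) * (j + 1) := by
  rcases lt_trichotomy i (2 * j + 1 + ε) with h | rfl | h
  · exact (gridWeight_row hε h).le
  · rw [gridWeight_row_last]
    interval_cases ε <;> nlinarith
  · rw [Finset.sum_eq_zero]
    · exact Nat.zero_le _
    · intro y _
      unfold gridWeight hexWeight
      split_ifs <;> omega

theorem sum_gridWeight {j ε : ℕ} (hε : ε ≤ 1) :
    ∑ p ∈ Finset.range (2 * j + 2 + ε) ×ˢ Finset.range (2 * j + 2 + ε), gridWeight j ε p.1 p.2 =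
      (2 * j + 1 + ε) * ((3 * j + 2 + 2 * ε) * (j + 1)) + (j + 1) * ((2 - ε) * j + 1) := by
  rw [Finset.sum_product, show Finset.range (2 * j + 2 + ε) = Finset.range (2 * j + 1 + ε + 1) by
    congr 1; ring, Finset.sum_range_succ, Finset.sum_congr rfl
      (g := fun _ => (3 * j + 2 + 2 * ε) * (j + 1))]
  · rw [Finset.sum_const, Finset.card_range, smul_eq_mul,
      show 2 * j + 1 + ε + 1 = 2 * j + 2 + ε by ring, gridWeight_row_last]
  · intro i hi
    rw [show 2 * j + 1 + ε + 1 = 2 * j + 2 + ε by ring]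
    exact gridWeight_row hε (Finset.mem_range.1 hi)

/-! ### Upper bounds for the dual weight on collinear points. -/

/-- Points in the support of `gridWeight` on a line of constant first coordinate. -/
theorem sum_gridWeight_le_of_fst {j ε : ℕ} (hε : ε ≤ 1) (T : Finset (ℕ × ℕ))
    (hT : ∀ p ∈ T, p.2 < 2 * j + 2 + ε) (hc : ∀ p ∈ T, ∀ q ∈ T, p.1 = q.1) :
    ∑ p ∈ T, gridWeight j ε p.1 p.2 ≤ (3 * j + 2 + 2 * ε) * (j + 1) := by
  rcases T.eq_empty_or_nonempty with rfl | ⟨q, hq⟩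
  · simp
  · refine le_trans ?_ (gridWeight_row_le (j := j) hε q.1)
    rw [Finset.sum_congr rfl (g := fun p : ℕ × ℕ => gridWeight j ε q.1 p.2)
      (fun p hp => by rw [hc q hq p hp]), ← Finset.sum_image (f := fun y => gridWeight j ε q.1 y)
      (g := Prod.snd) (fun a ha b hb h => Prod.ext (hc a ha b hb) h)]
    exact Finset.sum_le_sum_of_subset (Finset.image_subset_iff.2 fun p hp =>
      Finset.mem_range.2 (hT p hp))

theorem support_gridWeight {j ε x y : ℕ} (h : gridWeight j ε x y ≠ 0) :
    x + y ≤ 3 * j + 1 + ε ∧ x ≤ 2 * j + 1 + ε ∧ y ≤ 2 * j + 1 + ε ∧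
      3 * j + 1 + ε - x - y ≤ 2 * j + 1 + ε := by
  unfold gridWeight hexWeight at h
  split_ifs at h <;> omega

theorem sum_gridWeight_le_of_snd {j ε : ℕ} (hε : ε ≤ 1) (T : Finset (ℕ × ℕ))
    (hT : ∀ p ∈ T, gridWeight j ε p.1 p.2 ≠ 0) (hc : ∀ p ∈ T, ∀ q ∈ T, p.2 = q.2) :
    ∑ p ∈ T, gridWeight j ε p.1 p.2 ≤ (3 * j + 2 + 2 * ε) * (j + 1) := by
  rw [Finset.sum_congr rfl (fun p _ => gridWeight_swap j ε p.1 p.2)]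
  refine (Finset.sum_image (s := T) (f := fun p : ℕ × ℕ => gridWeight j ε p.1 p.2)
    (g := Prod.swap) Prod.swap_injective.injOn).symm.le.trans ?_
  apply sum_gridWeight_le_of_fst hε
  · simp only [Finset.forall_mem_image]
    intro p hp
    have := support_gridWeight (hT p hp)
    simp only [Prod.snd_swap]
    omega
  · simp only [Finset.forall_mem_image]
    exact hc

theorem sum_gridWeight_le_of_add {j ε : ℕ} (hε : ε ≤ 1) (T : Finset (ℕ × ℕ))
    (hT : ∀ p ∈ T, gridWeight j ε p.1 p.2 ≠ 0)
    (hc : ∀ p ∈ T, ∀ q ∈ T, p.1 + p.2 = q.1 + q.2) :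
    ∑ p ∈ T, gridWeight j ε p.1 p.2 ≤ (3 * j + 2 + 2 * ε) * (j + 1) := by
  -- Exchanging `x` and `z` turns constant `x + y` into constant first coordinate.
  have hinj : Set.InjOn (fun p : ℕ × ℕ => (3 * j + 1 + ε - p.1 - p.2, p.2)) T := by
    intro p hp q hq h
    have h1 := support_gridWeight (hT p hp)
    have h2 := support_gridWeight (hT q hq)
    simp only [Prod.mk.injEq] at h
    ext <;> omega
  rw [Finset.sum_congr rfl
    (fun p hp => (gridWeight_reflect (support_gridWeight (hT p hp)).1).symm)]
  refine (Finset.sum_image (f := fun p : ℕ × ℕ => gridWeight j ε p.1 p.2) hinj).symm.le.trans ?_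
  apply sum_gridWeight_le_of_fst hε
  · simp only [Finset.forall_mem_image]
    intro p hp
    have := support_gridWeight (hT p hp)
    omega
  · simp only [Finset.forall_mem_image]
    intro p hp q hq
    have := hc p hp q hq
    omega

/-- A set of points whose values of some barycentric coordinate `c` are pairwise at distance at
least `2` has small weight. -/
theorem sum_gridWeight_le_of_gap {j ε : ℕ} (hε : ε ≤ 1) (T : Finset (ℕ × ℕ)) (c : ℕ × ℕ → ℕ)
    (hc : ∀ p ∈ T, c p ≤ 2 * j + 1 + ε)
    (hw : ∀ p ∈ T, 2 * j + 1 + ε ≤ c p → gridWeight j ε p.1 p.2 ≤ (2 - ε) * j + 1)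
    (hgap : ∀ p ∈ T, ∀ q ∈ T, p ≠ q → c p + 2 ≤ c q ∨ c q + 2 ≤ c p) :
    ∑ p ∈ T, gridWeight j ε p.1 p.2 ≤ (3 * j + 2 + 2 * ε) * (j + 1) := by
  -- Each pair of values `{2k, 2k+1}` of `c` contains at most one point, and `g k` bounds its
  -- weight. The case `k = j + 1` forces `ε = 1` and `c p = K`, a boundary point.
  set g : ℕ → ℕ := fun k => if k ≤ j then 3 * j + 2 else j + 1 with hg
  have hle : ∀ p ∈ T, gridWeight j ε p.1 p.2 ≤ g (c p / 2) := by
    intro p hp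
    have h1 := hc p hp
    simp only [hg]
    split_ifs with h
    · unfold gridWeight
      split_ifs
      · exact hexWeight_le hε (by omega)
      · exact Nat.zero_le _
    · have h2 := hw p hp (by omega)
      obtain rfl : ε = 1 := by omega
      omega
  calc ∑ p ∈ T, gridWeight j ε p.1 p.2 ≤ ∑ p ∈ T, g (c p / 2) := Finset.sum_le_sum hle
    _ = ∑ k ∈ T.image (fun p => c p / 2), g k := by
        rw [Finset.sum_image]
        intro p hp q hq h
        by_contra hne
        have := hgap p hp q hq hne
        simp only at h
        omega
    _ ≤ ∑ k ∈ Finset.range (j + 1 + ε), g k := by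
        refine Finset.sum_le_sum_of_subset (Finset.image_subset_iff.2 fun p hp => ?_)
        have := hc p hp
        rw [Finset.mem_range]
        omega
    _ = (j + 1) * (3 * j + 2) + ε * (j + 1) := by
        rw [Finset.sum_range_add]
        congr 1
        · rw [Finset.sum_congr rfl (g := fun _ => 3 * j + 2)]
          · simp
          · intro k hk
            have := Finset.mem_range.1 hk
            simp only [hg]
            rw [if_pos (by omega)]
        · rw [Finset.sum_congr rfl (g := fun _ => j + 1)]
          · simp
          · intro k hk
            simp only [hg]
            rw [if_neg (by omega)]
    _ ≤ _ := by
        interval_cases ε <;> nlinarith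

/-! ### Lattice points, weak duality and the lower bound. -/

/-- The point of the plane with the given natural coordinates. -/
def latticePoint (p : ℕ × ℕ) : Fin 2 → ℝ := ![(p.1 : ℝ), (p.2 : ℝ)]

theorem latticePoint_mem_triangularGrid {m : ℕ} {p : ℕ × ℕ} (h : p.1 + p.2 ≤ m) :
    latticePoint p ∈ triangularGrid (m + 1) 2 := by
  refine ⟨![(p.1 : ℤ), (p.2 : ℤ)], ?_, ?_, ?_⟩
  · intro i
    fin_cases i <;> simp
  · simp only [Fin.sum_univ_two, Matrix.cons_val_zero, Matrix.cons_val_one]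
    push_cast
    omega
  · ext i
    fin_cases i <;> simp [latticePoint]

theorem exists_latticePoint_of_mem_triangularGrid {m : ℕ} {p : Fin 2 → ℝ}
    (h : p ∈ triangularGrid (m + 1) 2) : ∃ q : ℕ × ℕ, q.1 + q.2 ≤ m ∧ p = latticePoint q := by
  obtain ⟨x, hx, hs, rfl⟩ := h
  obtain ⟨a, ha⟩ := Int.eq_ofNat_of_zero_le (hx 0)
  obtain ⟨b, hb⟩ := Int.eq_ofNat_of_zero_le (hx 1)
  refine ⟨(a, b), ?_, ?_⟩
  · rw [Fin.sum_univ_two, ha, hb] at hs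
    push_cast at hs
    simp only
    omega
  · ext i
    fin_cases i <;> simp [latticePoint, ha, hb]

/-- Weak linear programming duality for fractional covers. -/
theorem sum_le_mul_coverSize {n d D : ℕ} {α : Type*} (S : Finset α) (P : α → Fin d → ℝ)
    (y : α → ℕ) (hP : ∀ a ∈ S, P a ∈ triangularGrid n d)
    (hy : ∀ H : AffineHyperplane d, ∀ T ⊆ S, (∀ a ∈ T, P a ∈ H.1) → ∑ a ∈ T, y a ≤ D)
    {w : AffineHyperplane d → ℝ≥0} (hw : IsFractionalCover n d w) :
    ((∑ a ∈ S, y a : ℕ) : ℝ≥0∞) ≤ D * coverSize w := by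
  classical
  calc ((∑ a ∈ S, y a : ℕ) : ℝ≥0∞) = ∑ a ∈ S, (y a : ℝ≥0∞) * 1 := by push_cast; simp
    _ ≤ ∑ a ∈ S, (y a : ℝ≥0∞) * ∑' H : {H : AffineHyperplane d // P a ∈ H.1}, (w H.1 : ℝ≥0∞) :=
        Finset.sum_le_sum fun a ha => by gcongr; exact hw _ (hP a ha)
    _ = ∑ a ∈ S, ∑' H : AffineHyperplane d, if P a ∈ H.1 then (y a : ℝ≥0∞) * w H else 0 := by
        refine Finset.sum_congr rfl fun a _ => ?_
        have := tsum_subtype {H : AffineHyperplane d | P a ∈ H.1} (fun H => (w H : ℝ≥0∞))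
        rw [show (∑' H : {H : AffineHyperplane d // P a ∈ H.1}, (w H.1 : ℝ≥0∞)) = _ from this,
          ← ENNReal.tsum_mul_left]
        refine tsum_congr fun H => ?_
        simp only [Set.indicator_apply, Set.mem_ofPred_eq, mul_ite, mul_zero]
    _ = ∑' H : AffineHyperplane d, ∑ a ∈ S, if P a ∈ H.1 then (y a : ℝ≥0∞) * w H else 0 :=
        (Summable.tsum_finsetSum fun _ _ => ENNReal.summable).symm
    _ ≤ ∑' H : AffineHyperplane d, (D : ℝ≥0∞) * w H := by
        refine ENNReal.tsum_le_tsum fun H => ?_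
        rw [← Finset.sum_filter, ← Finset.sum_mul]
        gcongr
        exact_mod_cast hy H _ (Finset.filter_subset _ _) fun a ha => (Finset.mem_filter.1 ha).2
    _ = D * coverSize w := ENNReal.tsum_mul_left

/-- The lattice points of a line of the plane have constant first coordinate, constant second
coordinate, constant coordinate sum, or one of these three separates them by at least `2`. -/
theorem latticePoint_line_cases (H : AffineHyperplane 2) (T : Set (ℕ × ℕ))
    (hT : ∀ p ∈ T, latticePoint p ∈ H.1) :
    (∀ p ∈ T, ∀ q ∈ T, p.1 = q.1) ∨ (∀ p ∈ T, ∀ q ∈ T, p.2 = q.2) ∨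
    (∀ p ∈ T, ∀ q ∈ T, p.1 + p.2 = q.1 + q.2) ∨
    (∀ p ∈ T, ∀ q ∈ T, p ≠ q → p.1 + 2 ≤ q.1 ∨ q.1 + 2 ≤ p.1) ∨
    (∀ p ∈ T, ∀ q ∈ T, p ≠ q → p.2 + 2 ≤ q.2 ∨ q.2 + 2 ≤ p.2) ∨
    (∀ p ∈ T, ∀ q ∈ T, p ≠ q → p.1 + p.2 + 2 ≤ q.1 + q.2 ∨ q.1 + q.2 + 2 ≤ p.1 + p.2) := by
  obtain ⟨v, -, hv⟩ := finrank_eq_one_iff'.1 (by have := H.2.2; omega :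
    Module.finrank ℝ H.1.direction = 1)
  obtain ⟨a, ha⟩ : ∃ a, a = v.1 0 := ⟨_, rfl⟩
  obtain ⟨b, hb⟩ : ∃ b, b = v.1 1 := ⟨_, rfl⟩
  have key : ∀ p ∈ T, ∀ q ∈ T, ∃ t : ℝ,
      (((p.1 : ℤ) - q.1 : ℤ) : ℝ) = t * a ∧ (((p.2 : ℤ) - q.2 : ℤ) : ℝ) = t * b := by
    intro p hp q hq
    obtain ⟨t, ht⟩ := hv ⟨latticePoint p -ᵥ latticePoint q,
      AffineSubspace.vsub_mem_direction (hT p hp) (hT q hq)⟩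
    have ht' := congrArg Subtype.val ht
    have h0 := congrFun ht' 0
    have h1 := congrFun ht' 1
    simp [latticePoint] at h0 h1
    exact ⟨t, by rw [ha]; push_cast; exact h0.symm, by rw [hb]; push_cast; exact h1.symm⟩
  have int_eq_zero : ∀ {z : ℤ}, (z : ℝ) = 0 → z = 0 := fun h => by exact_mod_cast h
  by_cases ha0 : a = 0
  · left
    intro p hp q hq
    obtain ⟨t, h1, -⟩ := key p hp q hq
    have := int_eq_zero (h1.trans (by rw [ha0, mul_zero]))
    omega
  by_cases hb0 : b = 0
  · right; left
    intro p hp q hq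
    obtain ⟨t, -, h1⟩ := key p hp q hq
    have := int_eq_zero (h1.trans (by rw [hb0, mul_zero]))
    omega
  by_cases hab : a + b = 0
  · right; right; left
    intro p hp q hq
    obtain ⟨t, h1, h2⟩ := key p hp q hq
    have : (p.1 : ℤ) - q.1 + (p.2 - q.2) = 0 := int_eq_zero (by
      push_cast at h1 h2 ⊢
      linear_combination h1 + h2 + t * hab)
    omega
  have ne : ∀ p ∈ T, ∀ q ∈ T, p ≠ q → ∃ t : ℝ, t ≠ 0 ∧
      (((p.1 : ℤ) - q.1 : ℤ) : ℝ) = t * a ∧ (((p.2 : ℤ) - q.2 : ℤ) : ℝ) = t * b := by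
    intro p hp q hq hne
    obtain ⟨t, h1, h2⟩ := key p hp q hq
    refine ⟨t, ?_, h1, h2⟩
    rintro rfl
    have e1 := int_eq_zero (h1.trans (zero_mul _))
    have e2 := int_eq_zero (h2.trans (zero_mul _))
    exact hne (Prod.ext (by omega) (by omega))
  -- two nonzero integers of the same sign have a sum of absolute value at least `2`
  have same : ∀ {z z' : ℤ} {t r s : ℝ}, t ≠ 0 → 0 < r * s → (z : ℝ) = t * r → (z' : ℝ) = t * s →
      2 ≤ z + z' ∨ z + z' ≤ -2 := by
    intro z z' t r s ht hrs h1 h2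
    have : 0 < z * z' := by
      have : (0 : ℝ) < z * z' := by
        rw [h1, h2, show t * r * (t * s) = t ^ 2 * (r * s) by ring]
        positivity
      exact_mod_cast this
    rcases pos_and_pos_or_neg_and_neg_of_mul_pos this with h | h <;> omega
  right; right; right
  -- Of `a`, `b`, `-(a + b)`, all nonzero with sum zero, two share a sign. The remaining coordinate
  -- then changes by at least `1 + 1` between distinct points.
  rcases lt_or_gt_of_ne (mul_ne_zero ha0 hb0) with hneg | hpos
  · rcases lt_or_gt_of_ne (mul_ne_zero ha0 hab) with h | h
    · right; left
      intro p hp q hq hne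
      obtain ⟨t, ht, h1, h2⟩ := ne p hp q hq hne
      have := same (z := (p.1 : ℤ) - q.1) (z' := -(p.1 - q.1 + (p.2 - q.2))) (r := a)
        (s := -(a + b)) ht (by linarith) h1 (by push_cast at h1 h2 ⊢; linear_combination -h1 - h2)
      omega
    · left
      intro p hp q hq hne
      obtain ⟨t, ht, h1, h2⟩ := ne p hp q hq hne
      have hs : 0 < (-b) * (a + b) := by
        have h3 : 0 < a ^ 2 := by positivity
        have h4 : 0 < (-(a * b)) * (a * (a + b)) := mul_pos (by linarith) h
        have h5 : (-(a * b)) * (a * (a + b)) = a ^ 2 * ((-b) * (a + b)) := by ring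
        exact pos_of_mul_pos_right (h5 ▸ h4) h3.le
      have := same (z := -((p.2 : ℤ) - q.2)) (z' := (p.1 - q.1 + (p.2 - q.2))) (r := -b)
        (s := a + b) ht hs (by push_cast at h1 h2 ⊢; linear_combination -h2)
        (by push_cast at h1 h2 ⊢; linear_combination h1 + h2)
      omega
  · right; right
    intro p hp q hq hne
    obtain ⟨t, ht, h1, h2⟩ := ne p hp q hq hne
    have := same ht hpos h1 h2
    omega

theorem gridWeight_line_le {j ε : ℕ} (hε : ε ≤ 1) (H : AffineHyperplane 2) (T : Finset (ℕ × ℕ))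
    (hT : ∀ p ∈ T, gridWeight j ε p.1 p.2 ≠ 0) (hH : ∀ p ∈ T, latticePoint p ∈ H.1) :
    ∑ p ∈ T, gridWeight j ε p.1 p.2 ≤ (3 * j + 2 + 2 * ε) * (j + 1) := by
  have hs := fun p hp => support_gridWeight (hT p hp)
  have hw : ∀ x y, 2 * j + 1 + ε ≤ x → gridWeight j ε x y ≤ (2 - ε) * j + 1 := by
    intro x y h
    unfold gridWeight
    split_ifs
    · exact hexWeight_of_edge h
    · exact Nat.zero_le _
  rcases latticePoint_line_cases H T hH with h | h | h | h | h | h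
  · exact sum_gridWeight_le_of_fst hε T (fun p hp => by have := hs p hp; omega) h
  · exact sum_gridWeight_le_of_snd hε T hT h
  · exact sum_gridWeight_le_of_add hε T hT h
  · exact sum_gridWeight_le_of_gap hε T (fun p => p.1) (fun p hp => (hs p hp).2.1)
      (fun p _ => hw _ _) h
  · exact sum_gridWeight_le_of_gap hε T (fun p => p.2) (fun p hp => (hs p hp).2.2.1)
      (fun p _ hp => gridWeight_swap j ε p.1 p.2 ▸ hw _ _ hp) h
  · refine sum_gridWeight_le_of_gap hε T (fun p => 3 * j + 1 + ε - p.1 - p.2)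
      (fun p hp => (hs p hp).2.2.2)
      (fun p hp hp' => gridWeight_reflect (hs p hp).1 ▸ hw _ _ hp') fun p hp q hq hne => ?_
    have h1 := hs p hp
    have h2 := hs q hq
    have h3 := h p hp q hq hne
    omega

theorem coverSize_lower_bound {j ε : ℕ} (hε : ε ≤ 1) {w : AffineHyperplane 2 → ℝ≥0}
    (hw : IsFractionalCover (3 * j + 1 + ε + 1) 2 w) :
    (((2 * j + 1 + ε) * ((3 * j + 2 + 2 * ε) * (j + 1)) + (j + 1) * ((2 - ε) * j + 1) : ℕ) : ℝ≥0∞) ≤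
      ((3 * j + 2 + 2 * ε) * (j + 1) : ℕ) * coverSize w := by
  rw [← sum_gridWeight hε, ← Finset.sum_filter_ne_zero]
  refine sum_le_mul_coverSize _ latticePoint _ (fun p hp => ?_) (fun H T hTS hTH => ?_) hw
  · exact latticePoint_mem_triangularGrid (support_gridWeight (Finset.mem_filter.1 hp).2).1
  · exact gridWeight_line_le hε H T (fun p hp => (Finset.mem_filter.1 (hTS hp)).2) hTH

/-! ### Construction of the optimal cover. -/

/-- The line through `p` with direction `v`. -/
def lineThrough (p v : Fin 2 → ℝ) (hv : v ≠ 0) : AffineHyperplane 2 :=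
  ⟨AffineSubspace.mk' p (Submodule.span ℝ {v}), AffineSubspace.mk'_nonempty _ _, by
    rw [AffineSubspace.direction_mk', finrank_span_singleton hv]⟩

theorem mem_lineThrough {p v q : Fin 2 → ℝ} {hv : v ≠ 0} {t : ℝ} (h : t • v = q - p) :
    q ∈ (lineThrough p v hv).1 := by
  rw [lineThrough, AffineSubspace.mem_mk', Submodule.mem_span_singleton]
  exact ⟨t, h⟩

open Classical in
/-- The weights that give the total weight `c i` to the `i`-th hyperplane of a finite family. -/
noncomputable def familyWeight {d : ℕ} (N : ℕ) (c : ℕ → ℝ≥0) (L : ℕ → AffineHyperplane d)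
    (H : AffineHyperplane d) : ℝ≥0 :=
  ∑ i ∈ Finset.range N, if H = L i then c i else 0

theorem coverSize_familyWeight {d : ℕ} (N : ℕ) (c : ℕ → ℝ≥0) (L : ℕ → AffineHyperplane d) :
    coverSize (familyWeight N c L) = ((∑ i ∈ Finset.range N, c i : ℝ≥0) : ℝ≥0∞) := by
  classical
  unfold coverSize familyWeight
  push_cast
  rw [Summable.tsum_finsetSum fun _ _ => ENNReal.summable]
  refine Finset.sum_congr rfl fun i _ => ?_
  rw [← tsum_ite_eq (L i) (fun _ => (c i : ℝ≥0∞))]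
  refine tsum_congr fun H => ?_
  split_ifs <;> simp

theorem le_familyWeight {d N : ℕ} (c : ℕ → ℝ≥0) (L : ℕ → AffineHyperplane d) {i : ℕ} (hi : i < N) :
    c i ≤ familyWeight N c L (L i) := by
  classical
  unfold familyWeight
  exact (if_pos rfl).symm.le.trans (Finset.single_le_sum
    (f := fun k => if L i = L k then c k else 0) (fun _ _ => zero_le) (Finset.mem_range.2 hi))

theorem le_tsum_familyWeight {d N : ℕ} (c : ℕ → ℝ≥0) (L : ℕ → AffineHyperplane d) {i : ℕ}
    (hi : i < N) {p : Fin d → ℝ} (hp : p ∈ (L i).1) :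
    (c i : ℝ≥0∞) ≤
      ∑' H : {H : AffineHyperplane d // p ∈ H.1}, (familyWeight N c L H.1 : ℝ≥0∞) :=
  le_trans (by exact_mod_cast le_familyWeight c L hi) (ENNReal.le_tsum
    (f := fun H : {H : AffineHyperplane d // p ∈ H.1} => (familyWeight N c L H.1 : ℝ≥0∞))
    ⟨L i, hp⟩)

/-- Weighting the three families of grid lines by a function of their distance to the side. -/
theorem exists_cover_of_weights (m : ℕ) (c : ℕ → ℝ≥0)
    (hc : ∀ x y z, x + y + z = m → 1 ≤ c x + c y + c z) :
    ∃ w : AffineHyperplane 2 → ℝ≥0, IsFractionalCover (m + 1) 2 w ∧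
      coverSize w = ((3 * ∑ i ∈ Finset.range (m + 1), c i : ℝ≥0) : ℝ≥0∞) := by
  have hv1 : (![0, 1] : Fin 2 → ℝ) ≠ 0 := fun h => by simpa using congrFun h 1
  have hv2 : (![1, 0] : Fin 2 → ℝ) ≠ 0 := fun h => by simpa using congrFun h 0
  have hv3 : (![1, -1] : Fin 2 → ℝ) ≠ 0 := fun h => by simpa using congrFun h 0
  let L1 : ℕ → AffineHyperplane 2 := fun i => lineThrough ![(i : ℝ), 0] ![0, 1] hv1
  let L2 : ℕ → AffineHyperplane 2 := fun i => lineThrough ![0, (i : ℝ)] ![1, 0] hv2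
  -- This is the line `x + y = m - i`, that is, `z = i`.
  let L3 : ℕ → AffineHyperplane 2 := fun i => lineThrough ![(m : ℝ) - i, 0] ![1, -1] hv3
  refine ⟨fun H => familyWeight (m + 1) c L1 H + familyWeight (m + 1) c L2 H +
    familyWeight (m + 1) c L3 H, ?_, ?_⟩
  · intro p hp
    obtain ⟨⟨x, y⟩, hxy, rfl⟩ := exists_latticePoint_of_mem_triangularGrid hp
    simp only at hxy
    obtain ⟨z, rfl⟩ := Nat.exists_eq_add_of_le hxy
    push_cast
    rw [ENNReal.tsum_add, ENNReal.tsum_add]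
    refine le_trans (b := (c x : ℝ≥0∞) + c y + c z) (by exact_mod_cast hc x y z rfl) ?_
    gcongr
    · refine le_tsum_familyWeight c L1 (by omega) (mem_lineThrough (t := (y : ℝ)) ?_)
      ext i
      fin_cases i <;> simp [latticePoint]
    · refine le_tsum_familyWeight c L2 (by omega) (mem_lineThrough (t := (x : ℝ)) ?_)
      ext i
      fin_cases i <;> simp [latticePoint]
    · refine le_tsum_familyWeight c L3 (by omega) (mem_lineThrough (t := -(y : ℝ)) ?_)
      ext i
      fin_cases i <;> simp [latticePoint]
  · have h := fun L : ℕ → AffineHyperplane 2 => coverSize_familyWeight (m + 1) c L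
    unfold coverSize at h ⊢
    push_cast at h ⊢
    rw [ENNReal.tsum_add, ENNReal.tsum_add, h, h, h]
    ring

theorem sum_range_tsub (K n : ℕ) : 2 * ∑ i ∈ Finset.range (K + n), (K - i) = K * (K + 1) := by
  induction K with
  | zero => simp
  | succ K ih =>
    rw [show K + 1 + n = K + n + 1 by ring, Finset.sum_range_succ', mul_add]
    simp only [Nat.add_sub_add_right, Nat.sub_zero]
    rw [ih]
    ring

theorem exists_cover (j ε : ℕ) :
    ∃ w : AffineHyperplane 2 → ℝ≥0, IsFractionalCover (3 * j + 1 + ε + 1) 2 w ∧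
      coverSize w = ENNReal.ofReal
        (3 * ((2 * j + 1 + ε) * (2 * j + 2 + ε)) / (2 * (3 * j + 2 + 2 * ε))) := by
  obtain ⟨w, hw, hs⟩ := exists_cover_of_weights (3 * j + 1 + ε)
    (fun i => ((2 * j + 1 + ε - i : ℕ) : ℝ≥0) / ((3 * j + 2 + 2 * ε : ℕ) : ℝ≥0)) (by
      intro x y z h
      rw [← add_div, ← add_div, one_le_div (by positivity)]
      norm_cast
      -- Truncated subtraction only increases the terms, so the sum is at least `3K - m`.
      omega)
  refine ⟨w, hw, hs.trans ?_⟩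
  rw [← ENNReal.ofReal_coe_nnreal]
  congr 1
  have h := sum_range_tsub (2 * j + 1 + ε) (j + 1)
  rw [show 2 * j + 1 + ε + (j + 1) = 3 * j + 1 + ε + 1 by ring] at h
  rw [← Finset.sum_div, ← Nat.cast_sum]
  have h' : (2 : ℝ) * ((∑ i ∈ Finset.range (3 * j + 1 + ε + 1), (2 * j + 1 + ε - i) : ℕ) : ℝ) =
      (2 * j + 1 + ε) * (2 * j + 1 + ε + 1) := by exact_mod_cast h
  push_cast [-Nat.cast_sum] at h' ⊢
  have hpos : (0 : ℝ) < 3 * j + 2 + 2 * ε := by positivity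
  field_simp
  linear_combination h'

/-- `hupper` identifies `V` with the size of the explicit cover, `hlower` with the total dual weight
divided by `D`. -/
theorem fStar_eq {j ε : ℕ} (hε : ε ≤ 1) {V : ℝ}
    (hupper : (3 * ((2 * j + 1 + ε) * (2 * j + 2 + ε)) / (2 * (3 * j + 2 + 2 * ε)) : ℝ) = V)
    (hlower : (((3 * j + 2 + 2 * ε) * (j + 1) : ℕ) : ℝ) * V =
      (((2 * j + 1 + ε) * ((3 * j + 2 + 2 * ε) * (j + 1)) + (j + 1) * ((2 - ε) * j + 1) : ℕ) : ℝ)) :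
    fStar (3 * j + 1 + ε + 1) 2 ∈ fractionalCoverSizes (3 * j + 1 + ε + 1) 2 ∧
      fStar (3 * j + 1 + ε + 1) 2 = ENNReal.ofReal V := by
  obtain ⟨w, hw, hs⟩ := exists_cover j ε
  rw [hupper] at hs
  have hmem : ENNReal.ofReal V ∈ fractionalCoverSizes (3 * j + 1 + ε + 1) 2 := ⟨w, hw, hs⟩
  have heq : fStar (3 * j + 1 + ε + 1) 2 = ENNReal.ofReal V := by
    refine le_antisymm (sInf_le hmem) (le_sInf ?_)
    rintro _ ⟨w', hw', rfl⟩
    have h := coverSize_lower_bound hε hw'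
    rw [← ENNReal.ofReal_natCast, ← hlower, ENNReal.ofReal_mul (by positivity),
      ENNReal.ofReal_natCast] at h
    exact (ENNReal.mul_le_mul_iff_right (Nat.cast_ne_zero.2 (by positivity))
      (ENNReal.natCast_ne_top _)).1 h
  exact ⟨heq ▸ hmem, heq⟩

theorem theorem2p2 (j : ℕ) :
    (fStar (3 * j + 2) 2 ∈ fractionalCoverSizes (3 * j + 2) 2 ∧
      fStar (3 * j + 2) 2 =
        ENNReal.ofReal (2 * (j : ℝ) + 1 + (2 * (j : ℝ) + 1) / (3 * (j : ℝ) + 2))) ∧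
    (fStar (3 * j + 3) 2 ∈ fractionalCoverSizes (3 * j + 3) 2 ∧
      fStar (3 * j + 3) 2 =
        ENNReal.ofReal (2 * (j : ℝ) + 2 + ((j : ℝ) + 1) / (3 * (j : ℝ) + 4))) := by
  have h2 : (0 : ℝ) < 3 * j + 2 := by positivity
  have h4 : (0 : ℝ) < 3 * j + 4 := by positivity
  constructor
  · refine fStar_eq (j := j) (ε := 0) (by norm_num) ?_ ?_
    · push_cast
      simp only [mul_zero, add_zero]
      field_simp
      ring
    · push_cast
      simp only [add_zero]
      field_simp
  · refine fStar_eq (j := j) (ε := 1) le_rfl ?_ ?_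
    · push_cast
      rw [show (3 * j + 2 + 2 * 1 : ℝ) = 3 * j + 4 by ring]
      field_simp
      ring
    · push_cast
      rw [show (3 * j + 2 + 2 : ℝ) = 3 * j + 4 by ring]
      field_simp
      ring
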